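/- **Setting.** Let $T$ be a finite set of primitive tests, let $\mathrm{Act}$ (actions) and $\mathrm{Out}$ (return values) be sets, and let $\mathbb S$ be a semiring with $1\neq 0$ that is - Conway: it carries an operation ${}^*$ with $(a+b)^*=a^*(ba^*)^*$ and $(ab)^*=1+a(ba)^*b$; - positive: $x+y=0$ implies $x=y=0$; - refinement: $x+y=z+w$ implies that there are $s,t,u,v$ with $s+t=x$, $s+u=z$, $u+v=y$, $t+v=w$. Tests are given by $b,c ::= \mathbb 0\mid\mathbb 1\mid t\in T\mid \bar b\mid b+c\mid bc$. Write $\equiv_{BA}$ for Boolean equivalence and $b\le_{BA}c$ for $b+c\equiv_{BA}c$. Let $\mathrm{At}$ be the (finite) set of atoms, i.e. of minimal nonzero classes of tests modulo $\equiv_{BA}$. An atom is used as a test through any representative. Expressions $\mathrm{Exp}$ are given by $$e,f ::= p\in\mathrm{Act}\mid b\mid e+_bf\mid e;f\mid e^{(b)}\mid v\in\mathrm{Out}\mid e\oplus_{r,s}f\qquad(r,s\in\mathbb S),$$ and $\odot r:=\mathbb 1\oplus_{r,0}\mathbb 0$. **Semantics.** Let $D=\{✗,✓\}+\mathrm{Out}+\mathrm{Act}\times\mathrm{Exp}$.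 For $e\in\mathrm{Exp}$ and $\alpha\in\mathrm{At}$ the finitely supported function $\partial(e)_\alpha:D\to\mathbb S$ is defined by recursion on $e$, where $\delta_x$ is $1$ at $x$ and $0$ elsewhere: - $\partial(p)_\alpha=\delta_{(p,\mathbb 1)}$ and $\partial(v)_\alpha=\delta_v$; - $\partial(b)_\alpha=\delta_✓$ if $\alpha\le_{BA}b$, and $\delta_✗$ if $\alpha\le_{BA}\bar b$; - $\partial(e+_bf)_\alpha=\partial(e)_\alpha$ if $\alpha\le_{BA} b$, and $\partial(f)_\alpha$ if $\alpha\le_{BA}\bar b$; - $\partial(e\oplus_{r,s}f)_\alpha=r\,\partial(e)_\alpha+s\,\partial(f)_\alpha$; - $\partial(e;f)_\alpha=\sum_{x\in D}\partial(e)_\alpha(x)\,c(x)$, where $c(✓)=\partial(f)_\alpha$, $c(x)=\delta_x$ for $x\in\{✗\}\cup\mathrm{Out}$, and $c(p,e')=\delta_{(p,\,e';f)}$; - $\partial(e^{(b)})_\alpha=\delta_✓$ if $\alpha\le_{BA}\bar b$. If $\alpha\le_{BA}b$, then $\partial(e^{(b)})_\alpha$ has value $\partial(e)_\alpha(✓)^*\,\partial(e)_\alpha(x)$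 at $x\in\{✗\}\cup\mathrm{Out}$, value $\partial(e)_\alpha(✓)^*\,\partial(e)_\alpha(p,e')$ at $(p,\,e';e^{(b)})$, and value $0$ elsewhere. Define also $E:\mathrm{Exp}\to\mathrm{At}\to\mathbb S$ by $E(p)_\alpha=E(v)_\alpha=0$; $E(b)_\alpha=1$ if $\alpha\le_{BA}b$ and $0$ otherwise; $E(e\oplus_{r,s}f)_\alpha=rE(e)_\alpha+sE(f)_\alpha$; $E(e+_bf)_\alpha=E(e)_\alpha$ if $\alpha\le_{BA}b$ and $E(f)_\alpha$ otherwise; $E(e;f)_\alpha=E(e)_\alpha E(f)_\alpha$; $E(e^{(b)})_\alpha=E(\bar b)_\alpha$. **Provable equality.** Let $\equiv$ be the smallest congruence on $\mathrm{Exp}$ (tests, including those in the guards $+_b$ and ${}^{(b)}$, being identified up to $\equiv_{BA}$) that satisfies the following axioms and rules, where $;$ binds tighter than $\oplus$ and $+_b$, and $\odot$ binds tightest: - $e+_be\equiv e$; $\ e+_bf\equiv b;e+_bf$; $\ e+_bf\equiv f+_{\bar b}e$; $\ (e+_bf)+_cg\equiv e+_{bc}(f+_cg)$; - $e\oplus_{r,s}(f+_bg)\equiv(e\oplus_{r,s}f)+_b(e\oplus_{r,s}g)$;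 $\ e\oplus_{r,s}(f\oplus_{t,u}g)\equiv e\oplus_{r,1}(f\oplus_{st,su}g)$; $\ b;(e\oplus_{r,s}f)\equiv b;(b;e\oplus_{r,s}b;f)$; - $\mathbb 1;e\equiv e\equiv e;\mathbb 1$; $\ (e;f);g\equiv e;(f;g)$; $\ \mathbb 0;e\equiv\mathbb 0$; $\ (e\oplus_{r,s}f);g\equiv e;g\oplus_{r,s}f;g$; $\ (e+_bf);g\equiv e;g+_bf;g$; $\ v;e\equiv v$; $\ b;c\equiv bc$; - $e^{(b)}\equiv e;e^{(b)}+_b\mathbb 1$; and if $e\equiv(f\oplus_{r,s}\mathbb 1)+_cg$, then $c;e^{(b)}\equiv c;\big((\odot(s^*r);f;e^{(b)})+_b\mathbb 1\big)$; - $\odot1\equiv\mathbb 1$; $\ \odot0;e\equiv\odot0$; - $e\oplus_{r,s}e\equiv\odot(r+s);e$; $\ e\oplus_{r,s}f\equiv f\oplus_{s,r}e$; $\ e\oplus_{r,s}(f\oplus_{t,u}g)\equiv(e\oplus_{r,st}f)\oplus_{1,su}g$; $\ e\oplus_{ru,s}f\equiv(\odot u;e)\oplus_{r,s}f$; - if $g\equiv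 e;g+_bf$ and $E(e)_\alpha=0$ for all $\alpha\in\mathrm{At}$, then $g\equiv e^{(b)};f$. **Generalized sums.** For $\Phi\subseteq\mathrm{At}$ and expressions $e_\alpha$, let $\sum^{+}_{\alpha\in\emptyset}e_\alpha=\mathbb 0$ and $\sum^{+}_{\alpha\in\Phi}e_\alpha=e_\gamma+_\gamma\sum^{+}_{\alpha\in\Phi\setminus\{\gamma\}}e_\alpha$ for a chosen $\gamma\in\Phi$. For a finite set $I$, weights $r_i$ and expressions $e_i$, let $\bigoplus_{i\in\emptyset}r_i\cdot e_i=\odot0$ and $\bigoplus_{i\in I}r_i\cdot e_i=e_j\oplus_{r_j,1}\bigoplus_{i\in I\setminus\{j\}}r_i\cdot e_i$ for a chosen $j\in I$. **Theorem (Fundamental Theorem).** For every $e\in\mathrm{Exp}$, $$e\equiv\sum^{+}_{\alpha\in\mathrm{At}}\Big(\bigoplus_{d\in\operatorname{supp}\partial(e)_\alpha}\partial(e)_\alpha(d)\cdot\exp(d)\Big),$$ where $\exp:D\to\mathrm{Exp}$ is given by $\exp(✗)=\mathbb 0$, $\exp(✓)=\mathbb 1$, $\exp(v)=v$ and $\exp(p,f)=p;f$.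 This holds for every order in which the generalized sums are unrolled and every choice of tests representing the atoms. -/

import Mathlib

namespace WGKAT

/-! ### Weights -/

/-- A Conway semiring: a semiring with a star operation satisfying the two Conway identities. -/
class ConwaySemiring (S : Type*) extends Semiring S, KStar S where
  kstar_add : ∀ a b : S, KStar.kstar (a + b) = KStar.kstar a * KStar.kstar (b * KStar.kstar a)
  kstar_mul : ∀ a b : S, KStar.kstar (a * b) = 1 + a * KStar.kstar (b * a) * b

/-- A monoid is positive (conical) if only the identity has an inverse. -/
def IsPositive (M : Type*) [AddMonoid M] : Prop :=
  ∀ x y : M, x + y = 0 → x = 0 ∧ y = 0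

/-- The refinement property of a monoid. -/
def IsRefinement (M : Type*) [AddMonoid M] : Prop :=
  ∀ x y z w : M, x + y = z + w →
    ∃ s t u v : M, s + t = x ∧ s + u = z ∧ u + v = y ∧ t + v = w

/-! ### Tests and atoms -/

/-- Boolean expressions (tests) over the set `T` of primitive tests. -/
inductive BExp (T : Type*) where
  | zero : BExp T
  | one : BExp T
  | prim (t : T) : BExp T
  | neg (b : BExp T) : BExp T
  | or (b c : BExp T) : BExp T
  | and (b c : BExp T) : BExp T

namespace BExp

variable {T : Type*}

/-- Truth value of a test under a valuation of the primitive tests. -/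
def eval (v : T → Bool) : BExp T → Bool
  | zero => false
  | one => true
  | prim t => v t
  | neg b => !(eval v b)
  | or b c => eval v b || eval v c
  | and b c => eval v b && eval v c

/-- Boolean equivalence: equality under all valuations. -/
instance setoid (T : Type*) : Setoid (BExp T) where
  r b c := ∀ v, eval v b = eval v c
  iseqv := ⟨fun _ _ => rfl, fun h v => (h v).symm, fun h k v => (h v).trans (k v)⟩

/-- Entailment of tests: `b ≤ c` if and only if `b + c` is Boolean equivalent to `c`. -/
def Entails (b c : BExp T) : Prop := or b c ≈ c

theorem entails_iff {b c : BExp T} :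
    Entails b c ↔ ∀ v, eval v b = true → eval v c = true := by
  refine forall_congr' fun v => ?_
  simp only [eval]
  cases eval v b <;> cases eval v c <;> simp

end BExp

/-- Tests modulo Boolean equivalence. -/
def BClass (T : Type*) : Type _ := Quotient (BExp.setoid T)

/-- The class of a test. -/
def BClass.mk {T : Type*} (b : BExp T) : BClass T := Quotient.mk (BExp.setoid T) b

/-- The order on classes induced by entailment. -/
instance (T : Type*) : PartialOrder (BClass T) where
  le := Quotient.lift₂ BExp.Entails (by
    intro a b c d hac hbd
    simp only [BExp.entails_iff, eq_iff_iff]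
    exact forall_congr' fun v => by rw [hac v, hbd v])
  le_refl a := by
    induction a using Quotient.inductionOn with
    | h a => exact BExp.entails_iff.2 fun _ h => h
  le_trans a b c := by
    induction a using Quotient.inductionOn with
    | h a =>
    induction b using Quotient.inductionOn with
    | h b =>
    induction c using Quotient.inductionOn with
    | h c =>
    intro h k
    exact BExp.entails_iff.2 fun v hv => BExp.entails_iff.1 k v (BExp.entails_iff.1 h v hv)
  le_antisymm a b := by
    induction a using Quotient.inductionOn with
    | h a =>
    induction b using Quotient.inductionOn with
    | h b =>
    intro h k
    exact Quotient.sound fun v =>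
      Bool.eq_iff_iff.2 ⟨BExp.entails_iff.1 h v, BExp.entails_iff.1 k v⟩

instance (T : Type*) : OrderBot (BClass T) where
  bot := BClass.mk BExp.zero
  bot_le a := by
    induction a using Quotient.inductionOn with
    | h a => exact BExp.entails_iff.2 fun _ h => by simp [BExp.eval] at h

/-- Atoms: the minimal nonzero classes of tests. -/
def At (T : Type*) : Type _ := {a : BClass T // IsAtom a}

/-- The atom `α` entails the test `b`. -/
def At.Below {T : Type*} (α : At T) (b : BExp T) : Prop := α.1 ≤ BClass.mk b

/-- An atom entails exactly one of `b` and its negation, so that a case distinction between the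
two can be written with `if ... then ... else`. -/
theorem At.below_neg_iff {T : Type*} (α : At T) (b : BExp T) :
    α.Below (BExp.neg b) ↔ ¬ α.Below b := by
  obtain ⟨a, ha⟩ := α
  induction a using Quotient.inductionOn with
  | h a =>
  constructor
  · intro h k
    refine ha.1 (le_antisymm ?_ bot_le)
    refine BExp.entails_iff.2 fun v hv => ?_
    have h1 := BExp.entails_iff.1 h v hv
    have h2 := BExp.entails_iff.1 k v hv
    simp [BExp.eval, h2] at h1
  · intro h
    have hle : BClass.mk (BExp.and a b) ≤ BClass.mk a :=
      BExp.entails_iff.2 fun v hv => by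
        simp only [BExp.eval, Bool.and_eq_true] at hv
        exact hv.1
    rcases ha.le_iff.1 hle with h0 | h0
    · refine BExp.entails_iff.2 fun v hv => ?_
      have := Quotient.exact h0 v
      simp only [BExp.eval, hv, Bool.true_and] at this
      simp [BExp.eval, this]
    · refine absurd (BExp.entails_iff.2 fun v hv => ?_) h
      have := Quotient.exact h0 v
      simpa [BExp.eval, hv] using this

instance (T : Type*) [Finite T] : Finite (BClass T) := by
  refine Finite.of_injective (β := (T → Bool) → Bool)
    (fun a => Quotient.lift (fun b v => BExp.eval v b) (fun _ _ h => funext h) a) ?_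
  intro a b
  induction a using Quotient.inductionOn with
  | h a =>
  induction b using Quotient.inductionOn with
  | h b => exact fun h => Quotient.sound fun v => congrFun h v

instance (T : Type*) [Finite T] : Finite (At T) :=
  inferInstanceAs (Finite {a : BClass T // IsAtom a})

noncomputable instance (T : Type*) [Finite T] : Fintype (At T) := Fintype.ofFinite _

/-! ### Expressions -/

/-- Expressions over primitive tests `T`, actions `Act`, return values `Out` and weights `S`:
`e.gch b f` is the guarded choice `e +_b f`, `e.wch r s f` the weighted choice of `e` with weight
`r` and `f` with weight `s`, `e.seq f` is `e ; f`, and `e.loop b` is `e^{(b)}`. -/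
inductive Exp (T Act Out S : Type*) where
  | act (p : Act) : Exp T Act Out S
  | test (b : BExp T) : Exp T Act Out S
  | gch (e : Exp T Act Out S) (b : BExp T) (f : Exp T Act Out S) : Exp T Act Out S
  | seq (e f : Exp T Act Out S) : Exp T Act Out S
  | loop (e : Exp T Act Out S) (b : BExp T) : Exp T Act Out S
  | ret (v : Out) : Exp T Act Out S
  | wch (e : Exp T Act Out S) (r s : S) (f : Exp T Act Out S) : Exp T Act Out S

/-- The set `2 + Out + Act × X`. -/
inductive Beh (Act Out X : Type*) where
  | reject : Beh Act Out X
  | accept : Beh Act Out X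
  | output (v : Out) : Beh Act Out X
  | step (p : Act) (x : X) : Beh Act Out X

namespace Exp

variable {T Act Out S : Type*}

/-- Abort, the false test. -/
def zero : Exp T Act Out S := test BExp.zero

/-- Skip, the true test. -/
def one : Exp T Act Out S := test BExp.one

/-- Scaling by `r`: the weighted choice of `one` with weight `r` and `zero` with weight `0`. -/
def scale [Zero S] (r : S) : Exp T Act Out S := wch one r 0 zero

/-! ### Operational semantics

Weightings on `X` over `S` are the finitely supported functions `X →₀ S`; the linearization of
`h : X → (Y →₀ S)` is `Finsupp.linearCombination S h`. -/

/-- The function whose linearization sends the weighting of `e` to that of `e ; f`; the first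
argument is the weighting of `f`. -/
noncomputable def seqCont [Semiring S] (df : Beh Act Out (Exp T Act Out S) →₀ S)
    (f : Exp T Act Out S) :
    Beh Act Out (Exp T Act Out S) → (Beh Act Out (Exp T Act Out S) →₀ S)
  | .accept => df
  | .reject => Finsupp.single .reject 1
  | .output v => Finsupp.single (.output v) 1
  | .step p e' => Finsupp.single (.step p (e'.seq f)) 1

open Classical in
/-- The transition function of the automaton of expressions. In the loop case with `α ≤ b`, all
weights are scaled by the star of the weight of immediate acceptance, acceptance is dropped, and
each step continues with the loop; see `deriv_loop_accept` and the lemmas after it. -/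
noncomputable def deriv [ConwaySemiring S] :
    Exp T Act Out S → At T → (Beh Act Out (Exp T Act Out S) →₀ S)
  | act p, _ => Finsupp.single (.step p one) 1
  | test b, α => if α.Below b then Finsupp.single .accept 1 else Finsupp.single .reject 1
  | gch e b f, α => if α.Below b then deriv e α else deriv f α
  | seq e f, α => Finsupp.linearCombination S (seqCont (deriv f α) f) (deriv e α)
  | loop e b, α =>
      if α.Below b then
        KStar.kstar (deriv e α .accept) •
          Finsupp.linearCombination S (seqCont 0 (e.loop b)) (deriv e α)
      else Finsupp.single .accept 1
  | ret v, _ => Finsupp.single (.output v) 1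
  | wch e r s f, α => r • deriv e α + s • deriv f α

section

variable [ConwaySemiring S] (e : Exp T Act Out S) (b : BExp T) (α : At T)

theorem deriv_loop_of_not_below (h : ¬ α.Below b) :
    deriv (e.loop b) α = Finsupp.single .accept 1 := by
  rw [deriv, if_neg h]

theorem deriv_loop_apply (h : α.Below b) (y : Beh Act Out (Exp T Act Out S)) :
    deriv (e.loop b) α y = KStar.kstar (deriv e α .accept) *
      (deriv e α).sum fun x w => w * seqCont 0 (e.loop b) x y := by
  rw [deriv, if_pos h, Finsupp.smul_apply, smul_eq_mul, Finsupp.linearCombination_apply,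
    Finsupp.sum_apply]
  rfl

theorem deriv_loop_accept (h : α.Below b) : deriv (e.loop b) α .accept = 0 := by
  rw [deriv_loop_apply e b α h, Finsupp.sum, Finset.sum_eq_zero, mul_zero]
  rintro (_ | _ | _ | _) _ <;> simp [seqCont]

theorem deriv_loop_reject (h : α.Below b) :
    deriv (e.loop b) α .reject = KStar.kstar (deriv e α .accept) * deriv e α .reject := by
  rw [deriv_loop_apply e b α h, Finsupp.sum_eq_single .reject]
  · simp [seqCont]
  · rintro (_ | _ | _ | _) _ h' <;> simp [seqCont] at h' ⊢
  · simp

theorem deriv_loop_output (h : α.Below b) (v : Out) :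
    deriv (e.loop b) α (.output v) =
      KStar.kstar (deriv e α .accept) * deriv e α (.output v) := by
  rw [deriv_loop_apply e b α h, Finsupp.sum_eq_single (.output v)]
  · simp [seqCont]
  · rintro (_ | _ | _ | _) _ h' <;> simp [seqCont] at h' ⊢
    simp [h']
  · simp

theorem deriv_loop_step (h : α.Below b) (p : Act) (e' : Exp T Act Out S) :
    deriv (e.loop b) α (.step p (e'.seq (e.loop b))) =
      KStar.kstar (deriv e α .accept) * deriv e α (.step p e') := by
  rw [deriv_loop_apply e b α h, Finsupp.sum_eq_single (.step p e')]
  · simp [seqCont]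
  · rintro (_ | _ | _ | ⟨q, g⟩) _ h' <;> simp [seqCont] at h' ⊢
    rw [Finsupp.single_eq_of_ne (by simpa [eq_comm] using h'), mul_zero]
  · simp

theorem deriv_loop_step_other (h : α.Below b) (p : Act) (x : Exp T Act Out S)
    (hx : ∀ e' : Exp T Act Out S, x ≠ e'.seq (e.loop b)) : deriv (e.loop b) α (.step p x) = 0 := by
  rw [deriv_loop_apply e b α h, Finsupp.sum, Finset.sum_eq_zero, mul_zero]
  rintro (_ | _ | _ | ⟨q, g⟩) _ <;> simp [seqCont]
  rw [Finsupp.single_eq_of_ne, mul_zero]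
  intro h'
  injection h' with _ h2
  exact hx g h2

end

open Classical in
/-- The weight of immediate acceptance, by recursion on the expression. -/
noncomputable def E [Semiring S] : Exp T Act Out S → At T → S
  | act _, _ => 0
  | test b, α => if α.Below b then 1 else 0
  | gch e b f, α => if α.Below b then E e α else E f α
  | seq e f, α => E e α * E f α
  | loop _ b, α => if α.Below b then 0 else 1
  | ret _, _ => 0
  | wch e r s f, α => r * E e α + s * E f α

/-! ### Axiomatization -/

/-- Provable equality: the least congruence containing the axioms and closed under the two
inference rules. Tests are taken up to Boolean equivalence, also in guards. -/
inductive Equiv [ConwaySemiring S] : Exp T Act Out S → Exp T Act Out S → Prop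
  | refl (e) : Equiv e e
  | symm {e f} : Equiv e f → Equiv f e
  | trans {e f g} : Equiv e f → Equiv f g → Equiv e g
  | test_congr {b c : BExp T} : b ≈ c → Equiv (test b) (test c)
  | gch_congr {e e' f f'} {b c : BExp T} :
      Equiv e e' → b ≈ c → Equiv f f' → Equiv (e.gch b f) (e'.gch c f')
  | seq_congr {e e' f f'} : Equiv e e' → Equiv f f' → Equiv (e.seq f) (e'.seq f')
  | loop_congr {e e'} {b c : BExp T} : Equiv e e' → b ≈ c → Equiv (e.loop b) (e'.loop c)
  | wch_congr {e e' f f'} (r s : S) :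
      Equiv e e' → Equiv f f' → Equiv (e.wch r s f) (e'.wch r s f')
  -- guarded choice
  | G1 (e b) : Equiv (gch e b e) e
  | G2 (e b f) : Equiv (gch e b f) (gch ((test b).seq e) b f)
  | G3 (e b f) : Equiv (gch e b f) (gch f b.neg e)
  | G4 (e b f c g) : Equiv (gch (gch e b f) c g) (gch e (b.and c) (gch f c g))
  -- distributivity
  | D1 (e r s f b g) : Equiv (wch e r s (gch f b g)) (gch (wch e r s f) b (wch e r s g))
  | D2 (e r s f t u g) :
      Equiv (wch e r s (wch f t u g)) (wch e r 1 (wch f (s * t) (s * u) g))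
  | D3 (b e r s f) :
      Equiv ((test b).seq (wch e r s f))
        ((test b).seq (wch ((test b).seq e) r s ((test b).seq f)))
  -- sequencing
  | S1_left (e) : Equiv (seq one e) e
  | S1_right (e) : Equiv (seq e one) e
  | S2 (e f g) : Equiv (seq (seq e f) g) (seq e (seq f g))
  | S3 (e) : Equiv (seq zero e) zero
  | S4 (e r s f g) : Equiv (seq (wch e r s f) g) (wch (seq e g) r s (seq f g))
  | S5 (e b f g) : Equiv (seq (gch e b f) g) (gch (seq e g) b (seq f g))
  | S6 (v e) : Equiv (seq (ret v) e) (ret v)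
  | S7 (b c) : Equiv (seq (test b) (test c)) (test (b.and c))
  -- loops
  | L1 (e b) : Equiv (loop e b) (gch (seq e (loop e b)) b one)
  | L2 {e f g c} {r s : S} (b) :
      Equiv e (gch (wch f r s one) c g) →
      Equiv ((test c).seq (e.loop b))
        ((test c).seq
          (gch (((scale (KStar.kstar s * r)).seq f).seq (e.loop b)) b one))
  -- scaling
  | C1 : Equiv (scale 1) one
  | C2 (e) : Equiv (seq (scale 0) e) (scale 0)
  -- weighted choice
  | W1 (e r s) : Equiv (wch e r s e) (seq (scale (r + s)) e)
  | W2 (e r s f) : Equiv (wch e r s f) (wch f s r e)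
  | W3 (e r s f t u g) :
      Equiv (wch e r s (wch f t u g)) (wch (wch e r (s * t) f) 1 (s * u) g)
  | W4 (e r u s f) : Equiv (wch e (r * u) s f) (wch (seq (scale u) e) r s f)
  -- fixpoint rule
  | F1 {e f g b} :
      Equiv g (gch (seq e g) b f) → (∀ α : At T, E e α = 0) → Equiv g (seq (loop e b) f)

/-! ### Generalized sums and the normal form -/

/-- The generalized guarded sum of the family `x`, unrolled in the order of the list; `rep α` is
the test that represents the atom `α` as a guard. -/
def guardedSum (rep : At T → BExp T) (x : At T → Exp T Act Out S) : List (At T) → Exp T Act Out S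
  | [] => zero
  | γ :: l => (x γ).gch (rep γ) (guardedSum rep x l)

/-- The generalized weighted sum of the `x i` with weights `r i`, unrolled in the order of the
list; the empty sum is scaling by zero. -/
def weightedSum [Semiring S] {ι : Type*} (r : ι → S) (x : ι → Exp T Act Out S) :
    List ι → Exp T Act Out S
  | [] => scale 0
  | j :: l => (x j).wch (r j) 1 (weightedSum r x l)

/-- The expression that performs a given behaviour. -/
def ofBeh : Beh Act Out (Exp T Act Out S) → Exp T Act Out S
  | .reject => zero
  | .accept => one
  | .output v => ret v
  | .step p f => (act p).seq f

end Exp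

end WGKAT

namespace WGKAT

open BExp

/-! ### Atoms: entailment by a representative, and the atoms covering every valuation. -/

section Atoms

variable {T : Type*}

/-! Fix a test `a` representing an atom `α` and identify `e` with `f` when `a;e ≡ a;f`. The axioms
turn the quotient `Under` into an `S`-module: the sum is the weighted choice with weights 1, 1, and
`r` acts by sequencing with `scale r` on the left. Sequencing with a fixed expression on the right
is linear. In this module the class of `e` is the linear combination of the classes of `ofBeh d`
with coefficients `e.deriv α d` (`Under.mk_eq_ofWeighting_deriv`). This is a structural induction:
guards are decided by the atom, sequencing is linearity, and a loop is unrolled once by `L2`, which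
produces the star (`Under.mk_loop`). Addition is commutative and associative in a module, so the
order of the weighted sum is irrelevant. The equalities under the single atoms are glued by case
distinctions into the guarded sum, because the disjunction of all atoms is the true test
(`equiv_guardedSum`). -/

theorem At.below_iff {α : At T} {a : BExp T} (ha : BClass.mk a = α.1) (b : BExp T) :
    α.Below b ↔ Entails a b := by
  rw [At.Below, ← ha]
  rfl

theorem BExp.and_equiv_left {a b : BExp T} (h : Entails a b) : a.and b ≈ a := fun v => by
  have := entails_iff.1 h v
  simp only [eval]
  cases ha : eval v a <;> simp_all

theorem BExp.and_equiv_zero {a b : BExp T} (h : Entails a b.neg) : a.and b ≈ zero := fun v => by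
  have := entails_iff.1 h v
  simp only [eval] at this ⊢
  cases ha : eval v a <;> simp_all

/-- The disjunction of a list of tests. -/
def BExp.disj : List (BExp T) → BExp T
  | [] => zero
  | b :: l => or b (disj l)

theorem BExp.eval_disj_of_mem {v : T → Bool} {b : BExp T} {l : List (BExp T)} (hb : b ∈ l)
    (h : eval v b = true) : eval v (disj l) = true := by
  induction l with
  | nil => simp at hb
  | cons c l ih =>
    rcases List.mem_cons.1 hb with rfl | hb
    · simp [disj, eval, h]
    · simp [disj, eval, ih hb]

/-- There are finitely many classes, so if the negated disjunction were nonzero, some atom would lie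
below it. That atom is itself a disjunct, which is a contradiction. -/
theorem BExp.disj_atoms [Finite T] {rep : At T → BExp T}
    (hrep : ∀ α, BClass.mk (rep α) = α.1) {l : List (At T)} (hl : ∀ α, α ∈ l) :
    disj (l.map rep) ≈ one := by
  have key : BClass.mk (disj (l.map rep)).neg = ⊥ := by
    by_contra hne
    obtain ⟨a, ha, hle⟩ :=
      (eq_bot_or_exists_atom_le (BClass.mk (disj (l.map rep)).neg)).resolve_left hne
    have h1 : Entails (rep ⟨a, ha⟩) (disj (l.map rep)).neg := (At.below_iff (hrep ⟨a, ha⟩) _).1 hle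
    refine ha.1 ((hrep ⟨a, ha⟩).symm.trans (le_antisymm ?_ bot_le))
    refine entails_iff.2 fun v hv => ?_
    have h2 := entails_iff.1 h1 v hv
    have h3 := eval_disj_of_mem (List.mem_map_of_mem (f := rep) (hl ⟨a, ha⟩)) hv
    simp [eval, h3] at h2
  intro v
  have := Quotient.exact key v
  simpa [eval] using this

end Atoms

namespace Exp

variable {T Act Out S : Type*} [ConwaySemiring S]

instance : Trans (Equiv (T := T) (Act := Act) (Out := Out) (S := S)) Equiv Equiv := ⟨Equiv.trans⟩

open WGKAT.Exp.Equiv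

/-! ### Guarded choice: reasoning under a test. -/

section Guards

variable {a b c : BExp T} {e f g k : Exp T Act Out S}

theorem test_seq_test_seq (b c : BExp T) (e : Exp T Act Out S) :
    Equiv ((test b).seq ((test c).seq e)) ((test (b.and c)).seq e) :=
  (S2 _ _ _).symm.trans (seq_congr (S7 b c) (refl e))

theorem test_seq_congr (h : b ≈ c) (e : Exp T Act Out S) :
    Equiv ((test b).seq e) ((test c).seq e) :=
  seq_congr (test_congr h) (refl e)

/-- `G2` puts the guard in front of the left branch, where the assumption applies; `G3` swaps the
branches to do the same on the right. -/
theorem gch_equiv_gch (h₁ : Equiv ((test b).seq e) ((test b).seq f))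
    (h₂ : Equiv ((test b.neg).seq g) ((test b.neg).seq k)) :
    Equiv (e.gch b g) (f.gch b k) := by
  calc
    Equiv (e.gch b g) (gch ((test b).seq e) b g) := G2 _ _ _
    Equiv _ (gch ((test b).seq f) b g) := gch_congr h₁ (fun _ => rfl) (refl _)
    Equiv _ (gch f b g) := (G2 _ _ _).symm
    Equiv _ (gch g b.neg f) := G3 _ _ _
    Equiv _ (gch ((test b.neg).seq g) b.neg f) := G2 _ _ _
    Equiv _ (gch ((test b.neg).seq k) b.neg f) := gch_congr h₂ (fun _ => rfl) (refl _)
    Equiv _ (gch k b.neg f) := (G2 _ _ _).symm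
    Equiv _ (gch f b k) := (G3 _ _ _).symm

/-- Proof by cases on `b`, since `G1` splits `e` into two copies of itself. -/
theorem equiv_gch (h₁ : Equiv ((test b).seq e) ((test b).seq f))
    (h₂ : Equiv ((test b.neg).seq e) ((test b.neg).seq g)) : Equiv e (f.gch b g) :=
  (G1 e b).symm.trans (gch_equiv_gch h₁ h₂)

theorem test_neg_seq_test_seq (b : BExp T) (e : Exp T Act Out S) :
    Equiv ((test b.neg).seq ((test b).seq e)) ((test b.neg).seq zero) :=
  calc
    Equiv _ ((test (b.neg.and b)).seq e) := test_seq_test_seq _ _ _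
    Equiv _ (zero.seq e) := test_seq_congr (fun v => by simp [eval]) e
    Equiv _ zero := S3 e
    Equiv _ (test (b.neg.and BExp.zero)) := test_congr fun v => by simp [eval]
    Equiv _ ((test b.neg).seq zero) := (S7 _ _).symm

theorem test_seq_equiv_gch_zero (b : BExp T) (e : Exp T Act Out S) :
    Equiv ((test b).seq e) (e.gch b zero) :=
  equiv_gch ((test_seq_test_seq b b e).trans (test_seq_congr (fun v => by simp [eval]) e))
    (test_neg_seq_test_seq b e)

/-- No axiom moves a test into a guarded choice from the left. Written as a guarded choice against
abort, the test can be reassociated by `G4`, and the remaining `b;f` aborts under the negation of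
`b`. -/
theorem test_seq_gch_self (b : BExp T) (e f : Exp T Act Out S) :
    Equiv ((test b).seq (e.gch b f)) ((test b).seq e) :=
  calc
    Equiv ((test b).seq (e.gch b f)) ((e.gch b f).gch b zero) := test_seq_equiv_gch_zero _ _
    Equiv _ (e.gch (b.and b) (f.gch b zero)) := G4 _ _ _ _ _
    Equiv _ (e.gch b ((test b).seq f)) :=
      gch_congr (refl _) (fun v => by simp [eval]) (test_seq_equiv_gch_zero b f).symm
    Equiv _ (e.gch b zero) := gch_equiv_gch (refl _) (test_neg_seq_test_seq b f)
    Equiv _ ((test b).seq e) := (test_seq_equiv_gch_zero b e).symm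

theorem test_seq_of_entails (h : Entails a b)
    (hef : Equiv ((test b).seq e) ((test b).seq f)) :
    Equiv ((test a).seq e) ((test a).seq f) := by
  have key (g : Exp T Act Out S) : Equiv ((test a).seq g) ((test a).seq ((test b).seq g)) :=
    (test_seq_congr (Setoid.symm (and_equiv_left h)) g).trans (test_seq_test_seq a b g).symm
  exact (key e).trans ((seq_congr (refl _) hef).trans (key f).symm)

theorem test_seq_gch_of_entails (h : Entails a b) (e f : Exp T Act Out S) :
    Equiv ((test a).seq (e.gch b f)) ((test a).seq e) :=
  test_seq_of_entails h (test_seq_gch_self b e f)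

theorem test_seq_gch_of_entails_neg (h : Entails a b.neg) (e f : Exp T Act Out S) :
    Equiv ((test a).seq (e.gch b f)) ((test a).seq f) :=
  (seq_congr (refl _) (G3 e b f)).trans (test_seq_gch_of_entails h f e)

/-- Induction with a case distinction on the head test: under it the disjunction holds and `hx`
applies; under its negation the head disjunct drops out. -/
theorem guardedSum_equiv_disj_seq {rep : At T → BExp T} {x : At T → Exp T Act Out S}
    (hx : ∀ α, Equiv ((test (rep α)).seq e) ((test (rep α)).seq (x α))) (l : List (At T)) :
    Equiv ((test (disj (l.map rep))).seq e) (guardedSum rep x l) := by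
  induction l with
  | nil => exact S3 e
  | cons γ l ih =>
    refine equiv_gch ?_ ?_
    · exact (test_seq_test_seq _ _ _).trans ((test_seq_congr (fun v => by
        simpa [disj, eval] using Or.inl) e).trans (hx γ))
    · refine Equiv.trans ?_ (seq_congr (refl _) ih)
      refine (test_seq_test_seq _ _ _).trans (Equiv.trans ?_ (test_seq_test_seq _ _ _).symm)
      refine test_seq_congr (fun v => ?_) e
      simp only [List.map_cons, disj, eval]
      cases eval v (rep γ) <;> simp

theorem equiv_guardedSum [Finite T] {rep : At T → BExp T}
    (hrep : ∀ α, BClass.mk (rep α) = α.1) {x : At T → Exp T Act Out S}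
    (hx : ∀ α, Equiv ((test (rep α)).seq e) ((test (rep α)).seq (x α)))
    {l : List (At T)} (hl : (l : Multiset (At T)) = Finset.univ.val) :
    Equiv e (guardedSum rep x l) := by
  have hmem (α : At T) : α ∈ l := by
    rw [← Multiset.mem_coe, hl]
    exact Finset.mem_univ α
  exact (S1_left e).symm.trans ((test_seq_congr (Setoid.symm (disj_atoms hrep hmem)) e).trans
    (guardedSum_equiv_disj_seq hx l))

end Guards

/-! ### Weighted choice: the module laws. -/

section Weights

theorem one_scale_seq (e : Exp T Act Out S) : Equiv ((scale 1).seq e) e :=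
  (seq_congr C1 (refl e)).trans (S1_left e)

theorem scale_seq_equiv_wch (r : S) (e : Exp T Act Out S) :
    Equiv ((scale r).seq e) (e.wch r 0 zero) :=
  (S4 _ _ _ _ _).trans (wch_congr _ _ (S1_left e) (S3 e))

theorem scale_mul (r s : S) :
    Equiv (scale (T := T) (Act := Act) (Out := Out) (r * s)) ((scale r).seq (scale s)) :=
  calc
    Equiv (scale (r * s)) (((scale s).seq one).wch r 0 zero) := W4 _ _ _ _ _
    Equiv _ ((scale s).wch r 0 zero) := wch_congr _ _ (S1_right _) (refl _)
    Equiv _ ((scale r).seq (scale s)) := (scale_seq_equiv_wch _ _).symm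

/-- Reduces every weighted choice to addition and scaling: `W4` extracts the left weight, and `W2`
brings the right weight into that position. -/
theorem wch_equiv_add (e : Exp T Act Out S) (r s : S) (f : Exp T Act Out S) :
    Equiv (e.wch r s f) (((scale r).seq e).wch 1 1 ((scale s).seq f)) := by
  have key (e : Exp T Act Out S) (r s : S) (f : Exp T Act Out S) :
      Equiv (e.wch r s f) (((scale r).seq e).wch 1 s f) := by
    simpa using W4 e 1 r s f
  exact (key e r s f).trans ((W2 _ _ _ _).trans ((key f s 1 _).trans (W2 _ _ _ _)))

theorem add_assoc' (e f g : Exp T Act Out S) :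
    Equiv (e.wch 1 1 (f.wch 1 1 g)) ((e.wch 1 1 f).wch 1 1 g) := by
  simpa using W3 e 1 1 f 1 1 g

theorem add_scale (r s : S) (e : Exp T Act Out S) :
    Equiv (((scale r).seq e).wch 1 1 ((scale s).seq e)) ((scale (r + s)).seq e) :=
  (wch_equiv_add e r s e).symm.trans (W1 e r s)

/-- By `C2` the summand `scale 0` is also `0` times `e`, so the sum is `(0 + 1)` times `e`. -/
theorem zero_add_equiv (e : Exp T Act Out S) : Equiv ((scale 0).wch 1 1 e) e := by
  have h := add_scale 0 1 e
  rw [zero_add] at h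
  exact (wch_congr 1 1 (C2 e).symm (one_scale_seq e).symm).trans (h.trans (one_scale_seq e))

theorem scale_add (s : S) (e f : Exp T Act Out S) :
    Equiv ((scale s).seq (e.wch 1 1 f))
      (((scale s).seq e).wch 1 1 ((scale s).seq f)) := by
  -- `D2` distributes an outer weight over an inner choice; a summand of weight 0 supplies the outer
  -- choice and is cancelled afterwards.
  have h := D2 zero 0 s e 1 1 f
  rw [mul_one] at h
  calc
    Equiv ((scale s).seq (e.wch 1 1 f)) ((e.wch 1 1 f).wch s 0 zero) := scale_seq_equiv_wch _ _
    Equiv _ (zero.wch 0 s (e.wch 1 1 f)) := W2 _ _ _ _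
    Equiv _ (zero.wch 0 1 (e.wch s s f)) := h
    Equiv _ (((scale 0).seq zero).wch 1 1 ((scale 1).seq (e.wch s s f))) := wch_equiv_add _ _ _ _
    Equiv _ ((scale 0).wch 1 1 (e.wch s s f)) := wch_congr _ _ (C2 _) (one_scale_seq _)
    Equiv _ (e.wch s s f) := zero_add_equiv _
    Equiv _ _ := wch_equiv_add _ _ _ _

/-- `D3` brings the test into both branches. This makes the module operations well defined on the
quotient. -/
theorem test_seq_wch_congr {a : BExp T} {e e' f f' : Exp T Act Out S} (r s : S)
    (he : Equiv ((test a).seq e) ((test a).seq e'))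
    (hf : Equiv ((test a).seq f) ((test a).seq f')) :
    Equiv ((test a).seq (e.wch r s f)) ((test a).seq (e'.wch r s f')) :=
  (D3 _ _ _ _ _).trans ((seq_congr (refl _) (wch_congr r s he hf)).trans (D3 _ _ _ _ _).symm)

theorem test_seq_scale_congr {a : BExp T} {e f : Exp T Act Out S} (r : S)
    (h : Equiv ((test a).seq e) ((test a).seq f)) :
    Equiv ((test a).seq ((scale r).seq e)) ((test a).seq ((scale r).seq f)) :=
  (seq_congr (refl _) (scale_seq_equiv_wch r e)).trans ((test_seq_wch_congr r 0 h (refl _)).trans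
    (seq_congr (refl _) (scale_seq_equiv_wch r f)).symm)

end Weights

/-! ### The module of expressions under a test -/

/-- Two expressions are identified if they are provably equal under the assumption `a`. -/
def underSetoid (Act Out S : Type*) [ConwaySemiring S] (a : BExp T) :
    Setoid (Exp T Act Out S) where
  r e f := Equiv ((test a).seq e) ((test a).seq f)
  iseqv := ⟨fun _ => refl _, Equiv.symm, Equiv.trans⟩

/-- Expressions up to provable equality under the assumption `a`. -/
def Under (Act Out S : Type*) [ConwaySemiring S] (a : BExp T) : Type _ :=
  Quotient (underSetoid Act Out S a)

namespace Under

variable {a : BExp T}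

/-- The class of an expression. -/
def mk (a : BExp T) (e : Exp T Act Out S) : Under Act Out S a :=
  Quotient.mk (underSetoid Act Out S a) e

theorem mk_surjective : Function.Surjective (mk (Act := Act) (Out := Out) (S := S) a) :=
  Quotient.mk_surjective

theorem mk_eq_iff {e f : Exp T Act Out S} :
    mk a e = mk a f ↔ Equiv ((test a).seq e) ((test a).seq f) :=
  Quotient.eq (r := underSetoid Act Out S a)

theorem mk_eq {e f : Exp T Act Out S} (h : Equiv e f) : mk a e = mk a f :=
  mk_eq_iff.2 (seq_congr (refl _) h)

/-- The zero vector is `scale 0`, not the abort test, which is the image of the behaviour `reject`.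
-/
instance : Zero (Under Act Out S a) := ⟨mk a (scale 0)⟩

instance : Add (Under Act Out S a) :=
  ⟨Quotient.map₂ (fun e f => e.wch 1 1 f) fun _ _ he _ _ hf => test_seq_wch_congr 1 1 he hf⟩

instance : SMul S (Under Act Out S a) :=
  ⟨fun r => Quotient.map (fun e => (scale r).seq e) fun _ _ h => test_seq_scale_congr r h⟩

theorem zero_add' (x : Under Act Out S a) : 0 + x = x := by
  obtain ⟨e, rfl⟩ := mk_surjective x
  exact mk_eq (zero_add_equiv e)

theorem add_comm' (x y : Under Act Out S a) : x + y = y + x := by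
  obtain ⟨e, rfl⟩ := mk_surjective x
  obtain ⟨f, rfl⟩ := mk_surjective y
  exact mk_eq (W2 e 1 1 f)

instance : AddCommMonoid (Under Act Out S a) where
  add_assoc x y z := by
    obtain ⟨e, rfl⟩ := mk_surjective x
    obtain ⟨f, rfl⟩ := mk_surjective y
    obtain ⟨g, rfl⟩ := mk_surjective z
    exact (mk_eq (add_assoc' e f g)).symm
  zero_add := zero_add'
  add_zero x := (add_comm' x 0).trans (zero_add' x)
  add_comm := add_comm'
  nsmul := nsmulRec

instance : Module S (Under Act Out S a) where
  one_smul x := by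
    obtain ⟨e, rfl⟩ := mk_surjective x
    exact mk_eq (one_scale_seq e)
  mul_smul r s x := by
    obtain ⟨e, rfl⟩ := mk_surjective x
    exact mk_eq ((seq_congr (scale_mul r s) (refl e)).trans (S2 _ _ _))
  smul_zero r := by
    refine mk_eq ((scale_mul r 0).symm.trans ?_)
    rw [mul_zero]
    exact refl _
  smul_add r x y := by
    obtain ⟨e, rfl⟩ := mk_surjective x
    obtain ⟨f, rfl⟩ := mk_surjective y
    exact mk_eq (scale_add r e f)
  add_smul r s x := by
    obtain ⟨e, rfl⟩ := mk_surjective x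
    exact (mk_eq (add_scale r s e)).symm
  zero_smul x := by
    obtain ⟨e, rfl⟩ := mk_surjective x
    exact mk_eq (C2 e)

theorem mk_wch (e : Exp T Act Out S) (r s : S) (f : Exp T Act Out S) :
    mk a (e.wch r s f) = r • mk a e + s • mk a f :=
  mk_eq (wch_equiv_add e r s f)

/-- Sequencing with a fixed expression on the right, as a linear map. -/
def seqRight (a : BExp T) (g : Exp T Act Out S) : Under Act Out S a →ₗ[S] Under Act Out S a where
  toFun := Quotient.map (fun e => e.seq g) fun _ _ h =>
    (S2 _ _ _).symm.trans ((seq_congr h (refl g)).trans (S2 _ _ _))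
  map_add' x y := by
    obtain ⟨e, rfl⟩ := mk_surjective x
    obtain ⟨f, rfl⟩ := mk_surjective y
    exact mk_eq (S4 e 1 1 f g)
  map_smul' r x := by
    obtain ⟨e, rfl⟩ := mk_surjective x
    exact mk_eq (S2 (scale r) e g)

theorem seqRight_mk (e g : Exp T Act Out S) : seqRight a g (mk a e) = mk a (e.seq g) := rfl

theorem mk_gch_of_entails {b : BExp T} (h : Entails a b) (e f : Exp T Act Out S) :
    mk a (e.gch b f) = mk a e :=
  mk_eq_iff.2 (test_seq_gch_of_entails h e f)

theorem mk_gch_of_entails_neg {b : BExp T} (h : Entails a b.neg) (e f : Exp T Act Out S) :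
    mk a (e.gch b f) = mk a f :=
  mk_eq_iff.2 (test_seq_gch_of_entails_neg h e f)

theorem mk_test_of_entails {b : BExp T} (h : Entails a b) :
    mk a (test b : Exp T Act Out S) = mk a one :=
  mk_eq_iff.2 ((S7 a b).trans ((test_congr (and_equiv_left h)).trans (S1_right _).symm))

theorem mk_test_of_entails_neg {b : BExp T} (h : Entails a b.neg) :
    mk a (test b : Exp T Act Out S) = mk a zero :=
  mk_eq_iff.2 ((S7 a b).trans ((test_congr fun v => (and_equiv_zero h v).trans (by
    simp [eval])).trans (S7 a BExp.zero).symm))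

theorem mk_weightedSum {ι : Type*} (r : ι → S) (x : ι → Exp T Act Out S) (l : List ι) :
    mk a (weightedSum r x l) = (l.map fun i => r i • mk a (x i)).sum := by
  induction l with
  | nil => rfl
  | cons j l ih => rw [weightedSum, mk_wch, ih, one_smul, List.map_cons, List.sum_cons]

/-- The class denoted by a weighting on behaviours. -/
noncomputable def ofWeighting (a : BExp T) :
    (Beh Act Out (Exp T Act Out S) →₀ S) →ₗ[S] Under Act Out S a :=
  Finsupp.linearCombination S fun d => mk a (ofBeh d)

theorem ofWeighting_single (d : Beh Act Out (Exp T Act Out S)) (r : S) :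
    ofWeighting a (Finsupp.single d r) = r • mk a (ofBeh d) :=
  Finsupp.linearCombination_single _ _ _

theorem mk_weightedSum_support (w : Beh Act Out (Exp T Act Out S) →₀ S)
    {l : List (Beh Act Out (Exp T Act Out S))}
    (hl : (l : Multiset (Beh Act Out (Exp T Act Out S))) = w.support.val) :
    mk a (weightedSum (fun d => w d) ofBeh l) = ofWeighting a w := by
  rw [mk_weightedSum, ofWeighting, Finsupp.linearCombination_apply, Finsupp.sum,
    Finset.sum_eq_multiset_sum, ← hl, Multiset.map_coe, Multiset.sum_coe]

/-- Sequencing after one behaviour is described by `seqCont`, provided that the weighting given for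
the second expression describes it whenever the behaviour is acceptance. -/
theorem mk_ofBeh_seq (w : Beh Act Out (Exp T Act Out S) →₀ S) (g : Exp T Act Out S)
    (d : Beh Act Out (Exp T Act Out S)) (h : d = .accept → mk a g = ofWeighting a w) :
    mk a ((ofBeh d).seq g) = ofWeighting a (seqCont w g d) := by
  cases d with
  | accept => exact (mk_eq (S1_left g)).trans (h rfl)
  | reject => rw [seqCont, ofWeighting_single, one_smul]; exact mk_eq (S3 g)
  | output v => rw [seqCont, ofWeighting_single, one_smul]; exact mk_eq (S6 v g)
  | step p f => rw [seqCont, ofWeighting_single, one_smul]; exact mk_eq (S2 _ f g)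

/-- Both sides are linear in `u`, so single behaviours suffice. The assumption on `g` is needed only
if `u` accepts; this lets the loop case take `w = 0` once acceptance is erased. -/
theorem seqRight_ofWeighting (u w : Beh Act Out (Exp T Act Out S) →₀ S) (g : Exp T Act Out S)
    (h : u .accept ≠ 0 → mk a g = ofWeighting a w) :
    seqRight a g (ofWeighting a u) =
      ofWeighting a (Finsupp.linearCombination S (seqCont w g) u) := by
  simp only [ofWeighting, Finsupp.linearCombination_apply, Finsupp.sum, map_sum, map_smul]
  refine Finset.sum_congr rfl fun d hd => congrArg _ ?_
  refine mk_ofBeh_seq w g d ?_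
  rintro rfl
  exact h (Finsupp.mem_support_iff.1 hd)

/-- Unrolling a loop under a test at which the body accepts immediately with weight `s`. -/
theorem mk_loop {b : BExp T} (h : Entails a b) {e : Exp T Act Out S} {s : S}
    {x : Under Act Out S a} (he : mk a e = x + s • mk a one) :
    mk a (e.loop b) = KStar.kstar s • seqRight a (e.loop b) x := by
  obtain ⟨f, rfl⟩ := mk_surjective x
  have he' : mk a e = mk a (f.wch 1 s one) := by rw [he, mk_wch, one_smul]
  -- `L2` needs a decomposition of `e` valid without assumptions: the guard is `a`, and off `a` the
  -- branch is `e` itself.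
  have hL := mk_eq_iff.2 (L2 b (equiv_gch (mk_eq_iff.1 he') (refl ((test a.neg).seq e))))
  rw [hL, mk_gch_of_entails h, mul_one, mk_eq (S2 _ _ _)]
  rfl

theorem mk_eq_ofWeighting_deriv {α : At T} (ha : BClass.mk a = α.1) (e : Exp T Act Out S) :
    mk a e = ofWeighting a (e.deriv α) := by
  have hpos {b : BExp T} (h : α.Below b) : Entails a b := (At.below_iff ha b).1 h
  have hneg {b : BExp T} (h : ¬ α.Below b) : Entails a b.neg :=
    hpos ((At.below_neg_iff α b).2 h)
  induction e with
  | act p =>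
    rw [deriv, ofWeighting_single, one_smul]
    exact (mk_eq (S1_right _)).symm
  | test b =>
    rw [deriv]
    split_ifs with h
    · rw [ofWeighting_single, one_smul]
      exact mk_test_of_entails (hpos h)
    · rw [ofWeighting_single, one_smul]
      exact mk_test_of_entails_neg (hneg h)
  | gch e b f ihe ihf =>
    rw [deriv]
    split_ifs with h
    · rw [mk_gch_of_entails (hpos h), ihe]
    · rw [mk_gch_of_entails_neg (hneg h), ihf]
  | seq e f ihe ihf =>
    rw [deriv, ← seqRight_ofWeighting _ _ _ fun _ => ihf, ← ihe, seqRight_mk]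
  | loop e b ih =>
    rw [deriv]
    split_ifs with h
    · have hsplit := Finsupp.erase_add_single Beh.accept (e.deriv α)
      have he : mk a e = ofWeighting a ((e.deriv α).erase .accept) +
          e.deriv α .accept • mk a one := by
        rw [ih]
        nth_rw 1 [← hsplit]
        rw [map_add, ofWeighting_single]
        rfl
      -- The erased weighting gives acceptance weight 0, so nothing has to be known about the class
      -- of the loop itself.
      rw [mk_loop (hpos h) he, map_smul, seqRight_ofWeighting _ 0 _ fun h0 => absurd (by simp) h0]
      -- Restoring acceptance changes nothing, as `seqCont 0` sends it to 0.
      nth_rw 4 [← hsplit]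
      rw [map_add, Finsupp.linearCombination_single, seqCont, smul_zero, add_zero]
    · rw [ofWeighting_single, one_smul, mk_eq (L1 e b), mk_gch_of_entails_neg (hneg h)]
      rfl
  | ret v =>
    rw [deriv, ofWeighting_single, one_smul]
    rfl
  | wch e r s f ihe ihf =>
    rw [deriv, mk_wch, map_add, map_smul, map_smul, ihe, ihf]

end Under

/-! ### The normal form at a single atom, and the assembly over all atoms. -/

theorem test_seq_equiv_weightedSum {a : BExp T} {α : At T} (ha : BClass.mk a = α.1)
    (e : Exp T Act Out S) {l : List (Beh Act Out (Exp T Act Out S))}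
    (hl : (l : Multiset (Beh Act Out (Exp T Act Out S))) = (e.deriv α).support.val) :
    Equiv ((test a).seq e) ((test a).seq (weightedSum (fun d => e.deriv α d) ofBeh l)) :=
  Under.mk_eq_iff.1 ((Under.mk_eq_ofWeighting_deriv ha e).trans
    (Under.mk_weightedSum_support _ hl).symm)

end Exp

end WGKAT

/-- Every expression is provably equal to the normal form read off its transitions, for every
order in which the sums over the atoms and over the supports are unrolled and every choice of
tests representing the atoms. -/
theorem mainTheorem5 {T Act Out S : Type*} [Finite T] [WGKAT.ConwaySemiring S] [Nontrivial S]
    (hpos : WGKAT.IsPositive S) (href : WGKAT.IsRefinement S)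
    (rep : WGKAT.At T → WGKAT.BExp T) (hrep : ∀ α, WGKAT.BClass.mk (rep α) = α.1)
    (atoms : List (WGKAT.At T)) (hatoms : (atoms : Multiset (WGKAT.At T)) = Finset.univ.val)
    (e : WGKAT.Exp T Act Out S)
    (supp : WGKAT.At T → List (WGKAT.Beh Act Out (WGKAT.Exp T Act Out S)))
    (hsupp : ∀ α, (supp α : Multiset (WGKAT.Beh Act Out (WGKAT.Exp T Act Out S))) =
      (e.deriv α).support.val) :
    e.Equiv (WGKAT.Exp.guardedSum rep
      (fun α => WGKAT.Exp.weightedSum (fun d => e.deriv α d) WGKAT.Exp.ofBeh (supp α))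
      atoms) := by
  exact WGKAT.Exp.equiv_guardedSum hrep
    (fun α => WGKAT.Exp.test_seq_equiv_weightedSum (hrep α) e (hsupp α)) hatoms
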